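/- Let $\mathbb E_1,\mathbb E_2$ be Euclidean spaces (finite-dimensional real inner product spaces). For $f:\mathbb E\to\mathbb R\cup\{+\infty\}$ let $\operatorname{dom} f=\{x: f(x)<+\infty\}$, $f^*(y)=\sup_x\{\langle y,x\rangle-f(x)\}$, and, for $\bar x\in\operatorname{dom} f$, $\partial f(\bar x)=\{v: f(\bar x)+\langle v,x-\bar x\rangle\le f(x)\ \forall x\in\mathbb E\}$. Let $\Gamma_0(\mathbb E)$ be the set of proper, convex, lower semicontinuous functions $\mathbb E\to\mathbb R\cup\{+\infty\}$. For $g\in\Gamma_0(\mathbb E)$ the horizon cone is $$\operatorname{hzn} g=\{w\in\mathbb E : y+tw\in C\ \text{ for all } y\in C,\ t>0\},\qquad C=\{y: g(y)\le\alpha\},$$ where $\alpha\in\mathbb R$ is any number for which $C\ne\emptyset$. For a cone $K\subset\mathbb E$ write $u\le_K v$ if $v-u\in K$, and call $g$ $K$-increasing if $u\le_K v$ implies $g(u)\le g(v)$. Let $\mathbb E_2^\bullet=\mathbb E_2\cup\{+\infty_\bullet\}$. A map $F:\mathbb E_1\to\mathbb E_2^\bullet$ with domain $\operatorname{dom}F=\{x:F(x)\in\mathbb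 E_2\}$ is called $K$-convex if its $K$-epigraph $\{(x,v)\in\operatorname{dom}F\times\mathbb E_2: F(x)\le_K v\}$ is convex. For $g:\mathbb E_2\to\mathbb R\cup\{+\infty\}$ and $v\in\mathbb E_2$ the functions $g\circ F$ and $\langle v,F\rangle$ on $\mathbb E_1$ are given by $g(F(x))$ and $\langle v,F(x)\rangle$ for $x\in\operatorname{dom}F$, and by $+\infty$ otherwise. Let $\operatorname{ri}$ denote the relative interior. **Theorem.** Let $g\in\Gamma_0(\mathbb E_2)$. Then $g$ is $(-\operatorname{hzn} g)$-increasing. Moreover, if $F:\mathbb E_1\to\mathbb E_2^\bullet$ is $(-\operatorname{hzn} g)$-convex and $$F(\operatorname{ri}(\operatorname{dom}F))\cap\operatorname{ri}(\operatorname{dom}g)\ne\emptyset,$$ then for all $p\in\mathbb E_1$ $$(g\circ F)^*(p)=\min_{v\in\mathbb E_2}\bigl(g^*(v)+\langle v,F\rangle^*(p)\bigr),$$ where the minimum is attained (its value may be $+\infty$), and for all $\bar x\in\operatorname{dom}(g\circ F)$ $$\partial(g\circ F)(\bar x)=\bigcup_{v\in\partial g(F(\bar x))}\partial\langle v,F\rangle(\bar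 x).$$ -/

import Mathlib

open scoped Pointwise

namespace ConvexComposite

/-! ### Extended real-valued functions on a Euclidean space -/

section Functions

variable {E : Type*} [NormedAddCommGroup E] [InnerProductSpace ℝ E]

/-- The effective domain of an extended real-valued function. -/
def dom (f : E → EReal) : Set E := {x | f x < ⊤}

/-- The epigraph, as a subset of `E × ℝ`. -/
def epi (f : E → EReal) : Set (E × ℝ) := {p | f p.1 ≤ (p.2 : EReal)}

/-- Proper, convex functions `E → ℝ ∪ {+∞}`. -/
structure MemΓ (f : E → EReal) : Prop where
  ne_bot : ∀ x, f x ≠ ⊥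
  dom_nonempty : (dom f).Nonempty
  convex_epi : Convex ℝ (epi f)

/-- Closed (lower semicontinuous), proper, convex functions `E → ℝ ∪ {+∞}`. -/
structure MemΓ₀ (f : E → EReal) : Prop extends MemΓ f where
  isClosed_epi : IsClosed (epi f)

/-- The Fenchel conjugate `f*(y) = sup_x (⟨y, x⟩ - f x)`. -/
noncomputable def conj (f : E → EReal) (y : E) : EReal :=
  ⨆ x : E, ((inner ℝ y x : ℝ) : EReal) - f x

/-- The subdifferential of `f` at a point `x₀` of its domain. -/
def subdiff (f : E → EReal) (x₀ : E) : Set E :=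
  {v | ∀ x : E, f x₀ + ((inner ℝ v (x - x₀) : ℝ) : EReal) ≤ f x}

/-- The sublevel set of `f` to the level `α`. -/
def lev (f : E → EReal) (α : ℝ) : Set E := {x | f x ≤ (α : EReal)}

/-- The horizon (recession) cone of a convex set. -/
def horizonCone (C : Set E) : Set E :=
  {w | ∀ x ∈ C, ∀ t : ℝ, 0 < t → x + t • w ∈ closure C}

/-- The horizon cone of `f`, computed from the sublevel set to the level `α`; here `α` is any
level for which that sublevel set is nonempty. -/
def hzn (f : E → EReal) (α : ℝ) : Set E := horizonCone (lev f α)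

/-- The relation `x ≤_K y`. -/
def leCone (K : Set E) (x y : E) : Prop := y - x ∈ K

/-- `g` is `K`-increasing: `u ≤_K v` implies `g u ≤ g v`. -/
def IsIncreasingWrt (K : Set E) (g : E → EReal) : Prop :=
  ∀ u v : E, leCone K u v → g u ≤ g v

end Functions

/-! ### Vector-valued functions with values in `E₂ ∪ {+∞}` -/

section Maps

variable {E₁ E₂ : Type*} [NormedAddCommGroup E₁] [InnerProductSpace ℝ E₁]
  [NormedAddCommGroup E₂] [InnerProductSpace ℝ E₂]

/-- The domain of a map with values in `E₂ ∪ {+∞}`. -/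
def mapDom (F : E₁ → WithTop E₂) : Set E₁ := {x | F x ≠ ⊤}

/-- The `K`-epigraph `{(x, v) | F x ≤_K v}`; no `v : E₂` dominates the value `+∞`. -/
def epiCone (K : Set E₂) (F : E₁ → WithTop E₂) : Set (E₁ × E₂) :=
  {p | ∃ y : E₂, F p.1 = (y : WithTop E₂) ∧ leCone K y p.2}

/-- `F` is `K`-convex. -/
def IsConvexWrt (K : Set E₂) (F : E₁ → WithTop E₂) : Prop := Convex ℝ (epiCone K F)

/-- The composition `g ∘ F`, with the value `+∞` outside the domain of `F`. -/
noncomputable def comp (g : E₂ → EReal) (F : E₁ → WithTop E₂) (x : E₁) : EReal :=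
  match F x with
  | none => ⊤
  | some y => g y

/-- The scalarization `⟨v, F⟩`, with the value `+∞` outside the domain of `F`. -/
noncomputable def scalarization (v : E₂) (F : E₁ → WithTop E₂) : E₁ → EReal :=
  comp (fun y => ((inner ℝ v y : ℝ) : EReal)) F

end Maps

end ConvexComposite

namespace ConvexComposite

/-! Monotonicity holds because a recession direction of one sublevel set of a closed convex `g` may
be added to every point of the epigraph (`add_mem_epi_of_mem_hzn`).

For the conjugate, `≤` is the sum of two Fenchel inequalities (`conj_comp_le`). Attainment is a
Lagrange multiplier argument (`exists_multiplier`): decouple the argument `y` of `g` from a `z`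
above `F x`, and record the defect `y - z` together with the objective. Convexity of `F` makes this
set convex, and monotonicity of `g` puts it above height `0` over zero defect. The relative interior
condition lets defects be reversed up to scale, so the supporting hyperplane is not vertical; its
slope is `v`.

The subdifferential formula uses the same multiplier, with the bound tight at the base point. -/

/-- If a convex set `D` in `V × ℝ` lies above the origin on the vertical axis, and its projection
to `V` absorbs its own negatives, then a linear functional supports `D` from below. -/
theorem exists_linearMap_le_of_convex {V : Type*} [AddCommGroup V] [Module ℝ V]
    {D : Set (V × ℝ)} (hD : Convex ℝ D) (hne : D.Nonempty)
    (hzero : ∀ t : ℝ, ((0 : V), t) ∈ D → 0 ≤ t)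
    (habs : ∀ p ∈ D, ∃ c : ℝ, 0 < c ∧ ∃ q ∈ D, q.1 = -(c • p.1)) :
    ∃ φ : V →ₗ[ℝ] ℝ, ∀ p ∈ D, φ p.1 ≤ p.2 := by
  -- By `habs`, the projection of the cone over `D` is symmetric, hence a whole subspace (`hspan`).
  have hneg : ∀ u t, (u, t) ∈ ConvexCone.hull ℝ D → ∃ r, (-u, r) ∈ ConvexCone.hull ℝ D := by
    intro u t h
    obtain ⟨c, hc, p, hp, hpe⟩ := (ConvexCone.mem_hull_of_convex hD).1 h
    obtain ⟨b, hb, q, hq, hqe⟩ := habs p hp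
    refine ⟨(c / b) * q.2, (ConvexCone.mem_hull_of_convex hD).2 ⟨c / b, by positivity, q, hq, ?_⟩⟩
    have hu : u = c • p.1 := (congrArg Prod.fst hpe).symm
    ext
    · simp only [Prod.smul_fst, hqe, hu, smul_neg, smul_smul]
      rw [div_mul_cancel₀ _ hb.ne']
    · simp
  have hspan : ∀ u ∈ Submodule.span ℝ (Prod.fst '' D), ∃ r, (u, r) ∈ ConvexCone.hull ℝ D := by
    intro u hu
    induction hu using Submodule.span_induction with
    | mem x hx =>
      obtain ⟨p, hp, rfl⟩ := hx
      exact ⟨p.2, ConvexCone.subset_hull hp⟩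
    | zero =>
      obtain ⟨p, hp⟩ := hne
      have h1 : (p.1, p.2) ∈ ConvexCone.hull ℝ D := ConvexCone.subset_hull hp
      obtain ⟨r, hr⟩ := hneg _ _ h1
      refine ⟨p.2 + r, ?_⟩
      rw [← add_neg_cancel p.1]
      exact (ConvexCone.hull ℝ D).add_mem h1 hr
    | add x y _ _ hx hy =>
      obtain ⟨r, hr⟩ := hx
      obtain ⟨q, hq⟩ := hy
      exact ⟨r + q, (ConvexCone.hull ℝ D).add_mem hr hq⟩
    | smul a x _ hx =>
      obtain ⟨r, hr⟩ := hx
      obtain ⟨q, hq⟩ := hneg _ _ hr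
      rcases lt_trichotomy a 0 with ha | rfl | ha
      · exact ⟨-a * q, by simpa using (ConvexCone.hull ℝ D).smul_mem (neg_pos.2 ha) hq⟩
      · exact ⟨r + q, by simpa using (ConvexCone.hull ℝ D).add_mem hr hq⟩
      · exact ⟨a * r, by simpa using (ConvexCone.hull ℝ D).smul_mem ha hr⟩
  -- Riesz extension starts from the height functional on `W' × ℝ`. The complement `W'` covers the
  -- directions that the cone does not reach, and over `W'` the cone lives only on the vertical
  -- axis.
  obtain ⟨W', hW'⟩ := (Submodule.span ℝ (Prod.fst '' D)).exists_isCompl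
  let f : V × ℝ →ₗ.[ℝ] ℝ :=
    ⟨W'.prod ⊤, (LinearMap.snd ℝ V ℝ).comp (W'.prod ⊤).subtype⟩
  have hle : ConvexCone.hull ℝ D ≤ (PointedCone.hull ℝ D).toConvexCone :=
    ConvexCone.hull_min PointedCone.subset_hull
  have hcases : ∀ x ∈ PointedCone.hull ℝ D, x = 0 ∨ x ∈ ConvexCone.hull ℝ D := by
    intro x hx
    induction hx using Submodule.span_induction with
    | mem x hx => exact Or.inr (ConvexCone.subset_hull hx)
    | zero => exact Or.inl rfl
    | add x y _ _ hx hy =>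
      rcases hx with rfl | hx
      · simpa using hy
      · rcases hy with rfl | hy
        · simpa using Or.inr hx
        · exact Or.inr ((ConvexCone.hull ℝ D).add_mem hx hy)
    | smul a x _ hx =>
      rcases hx with rfl | hx
      · simp
      · rcases a.2.eq_or_lt with ha | ha
        · left
          obtain rfl : a = 0 := Subtype.ext ha.symm
          exact zero_smul _ x
        · exact Or.inr ((ConvexCone.hull ℝ D).smul_mem ha hx)
  obtain ⟨G, hG, hGpos⟩ := riesz_extension (PointedCone.hull ℝ D) f
    (by
      intro ⟨⟨w, t⟩, hw⟩ hs
      rcases hcases _ hs with h0 | hs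
      · exact (congrArg Prod.snd h0).ge
      obtain ⟨c, hc, p, hp, hpe⟩ := (ConvexCone.mem_hull_of_convex hD).1 hs
      have h1 : c • p.1 = w := congrArg Prod.fst hpe
      have h2 : c * p.2 = t := congrArg Prod.snd hpe
      have hw0 : w = 0 := Submodule.disjoint_def.1 hW'.disjoint w
        (h1 ▸ Submodule.smul_mem _ _ (Submodule.subset_span ⟨p, hp, rfl⟩)) hw.1
      have hp0 : p.1 = 0 := (smul_eq_zero.1 (h1.trans hw0)).resolve_left hc.ne'
      have : 0 ≤ p.2 := hzero _ (by rw [← hp0]; exact hp)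
      change 0 ≤ t
      rw [← h2]
      positivity)
    (by
      rintro ⟨u, t⟩
      obtain ⟨a, ha, b, hb, rfl⟩ := Submodule.mem_sup.1
        (hW'.sup_eq_top ▸ Submodule.mem_top : u ∈ _ ⊔ W')
      obtain ⟨r, hr⟩ := hspan a ha
      -- The correction turns `(a + b, t)` into the cone element `(a, r)`.
      exact ⟨⟨(-b, r - t), ⟨W'.neg_mem hb, trivial⟩⟩, by simpa using hle hr⟩)
  refine ⟨-(G.comp (LinearMap.inl ℝ V ℝ)), fun p hp => ?_⟩
  have h1 := hGpos p (PointedCone.subset_hull hp)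
  have h2 : G ((0 : V), p.2) = p.2 := hG ⟨(0, p.2), ⟨W'.zero_mem, trivial⟩⟩
  have h3 : G p = G (p.1, 0) + G (0, p.2) := by rw [← map_add]; simp
  simp only [LinearMap.neg_apply, LinearMap.comp_apply, LinearMap.inl_apply]
  linarith

/-- From a relative interior point one can move a little in every direction of the affine span. -/
theorem exists_add_smul_mem_of_mem_intrinsicInterior {E : Type*} [NormedAddCommGroup E]
    [NormedSpace ℝ E] {A : Set E} {x d : E} (hx : x ∈ intrinsicInterior ℝ A)
    (hd : d ∈ (affineSpan ℝ A).direction) :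
    ∃ ε : ℝ, 0 < ε ∧ ε ≤ 1 ∧ x + ε • d ∈ A := by
  obtain ⟨y, hy, rfl⟩ := hx
  have hmem : ∀ t : ℝ, (y : E) + t • d ∈ affineSpan ℝ A := fun t => by
    rw [add_comm]
    exact AffineSubspace.vadd_mem_of_mem_direction (Submodule.smul_mem _ t hd) y.2
  have hcont : Continuous fun t : ℝ => (⟨(y : E) + t • d, hmem t⟩ : affineSpan ℝ A) := by
    fun_prop
  have hev : ∀ᶠ t in nhds (0 : ℝ), (y : E) + t • d ∈ A := by
    have h0 : (⟨(y : E) + (0 : ℝ) • d, hmem 0⟩ : affineSpan ℝ A) = y := by simp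
    have := hcont.continuousAt.preimage_mem_nhds (x := (0 : ℝ))
      (t := ((↑) ⁻¹' A : Set (affineSpan ℝ A))) (by rw [h0]; exact mem_interior_iff_mem_nhds.1 hy)
    exact this
  obtain ⟨δ, hδ, hball⟩ := Metric.eventually_nhds_iff.1 hev
  refine ⟨min (δ / 2) 1, by positivity, min_le_right _ _, hball ?_⟩
  rw [Real.dist_eq, sub_zero, abs_of_pos (by positivity)]
  exact (min_le_left _ _).trans_lt (by linarith)

section Basic

variable {E₁ E₂ : Type*}

theorem comp_of_eq_coe {g : E₂ → EReal} {F : E₁ → WithTop E₂} {x : E₁} {y : E₂}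
    (h : F x = (y : WithTop E₂)) : comp g F x = g y := by
  simp only [comp, h]

theorem comp_of_eq_top {g : E₂ → EReal} {F : E₁ → WithTop E₂} {x : E₁} (h : F x = ⊤) :
    comp g F x = ⊤ := by
  simp only [comp, h]

theorem mem_mapDom_iff {F : E₁ → WithTop E₂} {x : E₁} :
    x ∈ mapDom F ↔ ∃ y : E₂, F x = (y : WithTop E₂) := by
  simp only [mapDom, Set.mem_ofPred_eq, WithTop.ne_top_iff_exists, eq_comm]

end Basic

theorem isClosed_lev {E : Type*} [NormedAddCommGroup E] {g : E → EReal}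
    (hg : IsClosed (epi g)) (α : ℝ) : IsClosed (lev g α) :=
  hg.preimage (f := fun x : E => (x, α)) (by fun_prop)

/-! ### Monotonicity along the horizon cone -/

section Horizon

variable {E : Type*} [NormedAddCommGroup E] [InnerProductSpace ℝ E]

theorem zero_mem_hzn (g : E → EReal) (α : ℝ) : (0 : E) ∈ hzn g α := fun x hx t _ => by
  simpa using subset_closure hx

/-- Mix `(v, β)` with the far point `(y + t⁻¹ • w, α)` with weight `t`: the shift is exactly `w` for
each `t`, and the rest tends to `(v, β)` as `t → 0`. Closedness of the epigraph gives the limit. -/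
theorem add_mem_epi_of_mem_hzn {g : E → EReal} (hg : MemΓ₀ g) {α : ℝ}
    (hα : (lev g α).Nonempty) {w : E} (hw : w ∈ hzn g α) {v : E} {β : ℝ}
    (hv : (v, β) ∈ epi g) : (v + w, β) ∈ epi g := by
  obtain ⟨y, hy⟩ := hα
  have hmem : ∀ t ∈ Set.Ioo (0 : ℝ) 1,
      ((1 - t) • v + t • y + w, (1 - t) * β + t * α) ∈ epi g := by
    intro t ht
    have h1 : y + t⁻¹ • w ∈ lev g α := by
      have := hw y hy t⁻¹ (inv_pos.2 ht.1)
      rwa [(isClosed_lev hg.isClosed_epi α).closure_eq] at this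
    have h2 : (y + t⁻¹ • w, α) ∈ epi g := h1
    have h3 := hg.convex_epi hv h2 (sub_nonneg.2 ht.2.le) ht.1.le (by ring)
    simpa [smul_smul, mul_inv_cancel₀ ht.1.ne', ← add_assoc] using h3
  have hcont : Continuous fun t : ℝ =>
      ((1 - t) • v + t • y + w, (1 - t) * β + t * α) := by fun_prop
  have hlim := (hcont.tendsto 0).mono_left (nhdsWithin_le_nhds (s := Set.Ioi 0))
  simp only [sub_zero, one_smul, zero_smul, add_zero, one_mul, zero_mul] at hlim
  exact hg.isClosed_epi.mem_of_tendsto hlim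
    (Filter.mem_of_superset (Ioo_mem_nhdsGT one_pos) hmem)

theorem isIncreasingWrt_neg_hzn {g : E → EReal} (hg : MemΓ₀ g) {α : ℝ}
    (hα : (lev g α).Nonempty) : IsIncreasingWrt (-hzn g α) g := by
  intro u v huv
  refine EReal.le_of_forall_lt_iff_le.1 fun β hβ => ?_
  have hw : u - v ∈ hzn g α := by simpa [leCone] using huv
  have := add_mem_epi_of_mem_hzn hg hα hw (show (v, β) ∈ epi g from hβ.le)
  simpa [epi] using this

end Horizon

/-! ### Multipliers, conjugates and subdifferentials -/

section Duality

variable {E₁ E₂ : Type*} [NormedAddCommGroup E₁] [InnerProductSpace ℝ E₁]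
  [NormedAddCommGroup E₂] [InnerProductSpace ℝ E₂]

/-- Strong duality: an affine minorant of `g ∘ F` splits through a multiplier `v`. -/
theorem exists_multiplier [FiniteDimensional ℝ E₂] {g : E₂ → EReal} (hg : MemΓ g) {K : Set E₂}
    (hK : (0 : E₂) ∈ K) (hinc : IsIncreasingWrt K g) {F : E₁ → WithTop E₂}
    (hF : IsConvexWrt K F) {a : E₁} {b : E₂} (hab : F a = (b : WithTop E₂))
    (ha : a ∈ intrinsicInterior ℝ (mapDom F)) (hb : b ∈ intrinsicInterior ℝ (dom g))
    {p : E₁} {β : ℝ}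
    (hmin : ∀ (x : E₁) (y : E₂) (s : ℝ), F x = (y : WithTop E₂) → g y ≤ (s : EReal) →
      inner ℝ p x - s ≤ β) :
    ∃ v : E₂, ∀ (x : E₁) (z y : E₂) (s : ℝ), F x = (z : WithTop E₂) → g y ≤ (s : EReal) →
      (inner ℝ v y - s) + (inner ℝ p x - inner ℝ v z) ≤ β := by
  have hgraph : ∀ {x} {z : E₂}, F x = (z : WithTop E₂) → (x, z) ∈ epiCone K F := fun {x z} h =>
    ⟨z, h, by simpa [leCone] using hK⟩
  have hdom : ∀ {y}, y ∈ dom g → ∃ s : ℝ, g y ≤ (s : EReal) := fun {y} hy =>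
    ⟨(g y).toReal, EReal.le_coe_toReal hy.ne⟩
  let D : Set (E₂ × ℝ) :=
    {q | ∃ x z y s, (x, z) ∈ epiCone K F ∧ (y, s) ∈ epi g ∧
      q = (y - z, s - inner ℝ p x + β)}
  have hD : Convex ℝ D := by
    rintro _ ⟨x, z, y, s, h1, h2, rfl⟩ _ ⟨x', z', y', s', h1', h2', rfl⟩ c d hc hd hcd
    refine ⟨_, _, _, _, hF h1 h1' hc hd hcd, hg.convex_epi h2 h2' hc hd hcd, ?_⟩
    ext
    · simp only [Prod.fst_add, Prod.smul_fst, Prod.smul_snd, smul_sub]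
      abel
    · simp only [Prod.snd_add, Prod.smul_fst, Prod.smul_snd, smul_eq_mul, inner_add_right,
        inner_smul_right]
      linear_combination β * hcd
  have hne : D.Nonempty := by
    obtain ⟨s, hs⟩ := hdom (intrinsicInterior_subset hb)
    exact ⟨_, a, b, b, s, hgraph hab, hs, rfl⟩
  have hzero : ∀ t : ℝ, ((0 : E₂), t) ∈ D → 0 ≤ t := by
    rintro t ⟨x, z, y, s, ⟨w, hw, hwz⟩, h2, he⟩
    have hyz : y = z := (sub_eq_zero.1 (congrArg Prod.fst he).symm)
    have ht : t = s - inner ℝ p x + β := congrArg Prod.snd he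
    subst hyz
    have := hmin x w s hw ((hinc w y hwz).trans h2)
    linarith
  -- The qualification condition enters here. To reverse `y - z`, step from `a` away from `x` to a
  -- point with value `z₁`, and from `b` away from `y`. As `F` is only `K`-convex, a gap `k` appears
  -- and must be compensated on the side of `g`.
  have habs : ∀ q ∈ D, ∃ c : ℝ, 0 < c ∧ ∃ r ∈ D, r.1 = -(c • q.1) := by
    rintro _ ⟨x, z, y, s, h1, h2, rfl⟩
    have hx : x ∈ mapDom F := by
      obtain ⟨w, hw, -⟩ := h1
      exact mem_mapDom_iff.2 ⟨w, hw⟩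
    have hy : y ∈ dom g := lt_of_le_of_lt h2 (EReal.coe_lt_top s)
    have ha' := intrinsicInterior_subset ha
    have hb' := intrinsicInterior_subset hb
    obtain ⟨ε, hε, -, hmem⟩ := exists_add_smul_mem_of_mem_intrinsicInterior ha
      (AffineSubspace.vsub_mem_direction (subset_affineSpan ℝ _ ha') (subset_affineSpan ℝ _ hx))
    obtain ⟨z₁, hz₁⟩ := mem_mapDom_iff.1 hmem
    have hε1 : (1 + ε) ≠ 0 := by positivity
    -- `k ∈ K` is the convexity gap of `F` at `a`
    obtain ⟨k, hk, hkz⟩ : ∃ k ∈ K, (1 + ε) • k = z₁ + ε • z - (1 + ε) • b := by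
      obtain ⟨w, hw, hwk⟩ := hF (hgraph hz₁) h1 (a := (1 + ε)⁻¹) (b := (1 + ε)⁻¹ * ε)
        (by positivity) (by positivity) (by field_simp)
      have hpt : (1 + ε)⁻¹ • (a + ε • (a -ᵥ x)) + ((1 + ε)⁻¹ * ε) • x = a := by
        rw [mul_smul, ← smul_add, vsub_eq_sub, inv_smul_eq_iff₀ hε1]
        module
      simp only [Prod.smul_mk, Prod.mk_add_mk, hpt, hab] at hw hwk
      obtain rfl : b = w := WithTop.coe_injective hw
      refine ⟨_, hwk, ?_⟩
      rw [mul_smul, ← smul_add, smul_sub, smul_inv_smul₀ hε1]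
    have hbk : b - k ∈ dom g :=
      lt_of_le_of_lt (hinc (b - k) b (by simpa [leCone] using hk)) hb'
    -- The term `(1 + ε) • k` cancels the gap: after a step `δ`, the new defect is exactly `-(δ * ε)
    -- • (y - z)`. It is an admissible direction because monotonicity puts `b - k` in `dom g`.
    have hdir : ε • (b -ᵥ y) + (1 + ε) • (b -ᵥ (b - k)) ∈ (affineSpan ℝ (dom g)).direction :=
      Submodule.add_mem _
        (Submodule.smul_mem _ _ (AffineSubspace.vsub_mem_direction
          (subset_affineSpan ℝ _ hb') (subset_affineSpan ℝ _ hy)))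
        (Submodule.smul_mem _ _ (AffineSubspace.vsub_mem_direction
          (subset_affineSpan ℝ _ hb') (subset_affineSpan ℝ _ hbk)))
    obtain ⟨δ, hδ, hδ1, hδmem⟩ := exists_add_smul_mem_of_mem_intrinsicInterior hb hdir
    obtain ⟨s', hs'⟩ := hdom hδmem
    refine ⟨δ * ε, by positivity, _, ⟨_, _, _, s',
      hF (hgraph hab) (hgraph hz₁) (sub_nonneg.2 hδ1) hδ.le (by ring), hs', rfl⟩, ?_⟩
    simp only [Prod.smul_mk, vsub_eq_sub, sub_sub_cancel, hkz]
    module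
  obtain ⟨φ, hφ⟩ := exists_linearMap_le_of_convex hD hne hzero habs
  refine ⟨(InnerProductSpace.toDual ℝ E₂).symm φ.toContinuousLinearMap,
    fun x z y s hx hs => ?_⟩
  have := hφ _ ⟨x, z, y, s, hgraph hx, hs, rfl⟩
  simp only [InnerProductSpace.toDual_symm_apply, LinearMap.coe_toContinuousLinearMap']
  simp only [map_sub] at this
  linarith

theorem inner_sub_le_conj {E : Type*} [NormedAddCommGroup E] [InnerProductSpace ℝ E]
    (f : E → EReal) (y x : E) : ((inner ℝ y x : ℝ) : EReal) - f x ≤ conj f y :=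
  le_iSup (fun x : E => ((inner ℝ y x : ℝ) : EReal) - f x) x

/-- Weak duality. -/
theorem conj_comp_le {g : E₂ → EReal} (hg : ∀ y, g y ≠ ⊥) (F : E₁ → WithTop E₂) (p : E₁)
    (v : E₂) : conj (comp g F) p ≤ conj g v + conj (scalarization v F) p := by
  refine iSup_le fun x => ?_
  rcases hx : F x with _ | y
  · rw [comp_of_eq_top hx]
    simp
  · replace hx : F x = (y : WithTop E₂) := hx
    rw [comp_of_eq_coe hx]
    have h1 := inner_sub_le_conj g v y
    have h2 := inner_sub_le_conj (scalarization v F) p x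
    rw [scalarization, comp_of_eq_coe hx] at h2
    refine le_trans ?_ (add_le_add h1 h2)
    induction hgy : g y with
    | bot => exact absurd hgy (hg y)
    | top => simp
    | coe s =>
      norm_cast
      linarith

/-- The bound separates the variables, so take the supremum over `y` first, then over `x`. The point
`a` bounds `conj g v` above and properness of `g` bounds it below, so it can be subtracted. -/
theorem conj_add_conj_le_of_multiplier {g : E₂ → EReal} (hg : MemΓ g) {F : E₁ → WithTop E₂} {p : E₁}
    {v : E₂} {β : ℝ} {a : E₁} {b : E₂} (hab : F a = (b : WithTop E₂))
    (h : ∀ (x : E₁) (z y : E₂) (s : ℝ), F x = (z : WithTop E₂) → g y ≤ (s : EReal) →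
      (inner ℝ v y - s) + (inner ℝ p x - inner ℝ v z) ≤ β) :
    conj g v + conj (scalarization v F) p ≤ (β : EReal) := by
  have h1 : ∀ (x : E₁) (z : E₂), F x = (z : WithTop E₂) →
      conj g v ≤ ((β - (inner ℝ p x - inner ℝ v z) : ℝ) : EReal) := by
    intro x z hx
    refine iSup_le fun y => ?_
    induction hgy : g y with
    | bot => exact absurd hgy (hg.ne_bot y)
    | top => simp
    | coe s =>
      have := h x z y s hx hgy.le
      norm_cast
      linarith
  have hbot : conj g v ≠ ⊥ := by
    obtain ⟨y, hy⟩ := hg.dom_nonempty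
    refine ne_bot_of_le_ne_bot ?_ (inner_sub_le_conj g v y)
    lift g y to ℝ using ⟨hy.ne, hg.ne_bot y⟩ with s
    exact EReal.coe_ne_bot _
  have htop : conj g v ≠ ⊤ := ((h1 a b hab).trans_lt (EReal.coe_lt_top _)).ne
  lift conj g v to ℝ using ⟨htop, hbot⟩ with c
  have h2 : conj (scalarization v F) p ≤ ((β - c : ℝ) : EReal) := by
    refine iSup_le fun x => ?_
    rcases hx : F x with _ | z
    · rw [scalarization, comp_of_eq_top hx]
      simp
    · replace hx : F x = (z : WithTop E₂) := hx
      rw [scalarization, comp_of_eq_coe hx]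
      have := EReal.coe_le_coe_iff.1 (h1 x z hx)
      norm_cast
      linarith
  calc (c : EReal) + conj (scalarization v F) p ≤ c + ((β - c : ℝ) : EReal) := by gcongr
    _ = β := by norm_cast; ring

theorem mem_subdiff_comp {g : E₂ → EReal} {F : E₁ → WithTop E₂} {x₀ : E₁}
    {y₀ v : E₂} (hx₀ : F x₀ = (y₀ : WithTop E₂)) {w : E₁} (hv : v ∈ subdiff g y₀)
    (hw : w ∈ subdiff (scalarization v F) x₀) : w ∈ subdiff (comp g F) x₀ := by
  intro x
  rcases hx : F x with _ | y
  · rw [comp_of_eq_top hx]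
    exact le_top
  · replace hx : F x = (y : WithTop E₂) := hx
    rw [comp_of_eq_coe hx, comp_of_eq_coe hx₀]
    have h1 := hv y
    have h2 := hw x
    rw [scalarization, comp_of_eq_coe hx, comp_of_eq_coe hx₀] at h2
    refine le_trans ?_ h1
    gcongr
    norm_cast at h2
    rw [inner_sub_right v]
    linarith

/-- A subgradient `w` is an affine minorant touching at `x₀`. Its multiplier inequality is tight at
`(x₀, y₀)`; fixing `x = x₀` gives the subgradient inequality for `g`, and fixing `y = y₀` the one
for `⟨v, F⟩`. -/
theorem exists_mem_subdiff_of_mem_subdiff_comp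
    [FiniteDimensional ℝ E₂]
    {g : E₂ → EReal} (hg : MemΓ g) {K : Set E₂}
    (hK : (0 : E₂) ∈ K) (hinc : IsIncreasingWrt K g) {F : E₁ → WithTop E₂}
    (hF : IsConvexWrt K F) {a : E₁} {b : E₂} (hab : F a = (b : WithTop E₂))
    (ha : a ∈ intrinsicInterior ℝ (mapDom F)) (hb : b ∈ intrinsicInterior ℝ (dom g))
    {x₀ : E₁} {y₀ : E₂} (hx₀ : F x₀ = (y₀ : WithTop E₂)) (hy₀ : g y₀ < ⊤) {w : E₁}
    (hw : w ∈ subdiff (comp g F) x₀) :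
    ∃ v ∈ subdiff g y₀, w ∈ subdiff (scalarization v F) x₀ := by
  obtain ⟨s₀, hs₀⟩ : ∃ s₀ : ℝ, g y₀ = s₀ :=
    ⟨_, (EReal.coe_toReal hy₀.ne (hg.ne_bot y₀)).symm⟩
  obtain ⟨v, hv⟩ := exists_multiplier hg hK hinc hF hab ha hb (p := w)
    (β := inner ℝ w x₀ - s₀) (fun x y s hx hs => by
      have h1 := (hw x)
      rw [comp_of_eq_coe hx, comp_of_eq_coe hx₀, hs₀] at h1
      have h2 := h1.trans hs
      norm_cast at h2
      rw [inner_sub_right] at h2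
      linarith)
  refine ⟨v, fun y => ?_, fun x => ?_⟩
  · refine EReal.le_of_forall_lt_iff_le.1 fun s hs => ?_
    have := hv x₀ y₀ y s hx₀ hs.le
    rw [hs₀, inner_sub_right]
    norm_cast
    linarith
  · rcases hx : F x with _ | z
    · rw [scalarization, comp_of_eq_top hx]
      exact le_top
    · replace hx : F x = (z : WithTop E₂) := hx
      have := hv x z y₀ s₀ hx hs₀.le
      rw [scalarization, comp_of_eq_coe hx, comp_of_eq_coe hx₀, inner_sub_right]
      norm_cast
      linarith

end Duality

end ConvexComposite

theorem mainTheorem5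
    {E₁ E₂ : Type*}
    [NormedAddCommGroup E₁] [InnerProductSpace ℝ E₁] [FiniteDimensional ℝ E₁]
    [NormedAddCommGroup E₂] [InnerProductSpace ℝ E₂] [FiniteDimensional ℝ E₂]
    (g : E₂ → EReal) (hg : ConvexComposite.MemΓ₀ g)
    (α : ℝ) (hα : (ConvexComposite.lev g α).Nonempty) :
    ConvexComposite.IsIncreasingWrt (-ConvexComposite.hzn g α) g ∧
    ∀ F : E₁ → WithTop E₂,
      ConvexComposite.IsConvexWrt (-ConvexComposite.hzn g α) F →
      ((F '' intrinsicInterior ℝ (ConvexComposite.mapDom F)) ∩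
        ((fun y : E₂ => (y : WithTop E₂)) ''
          intrinsicInterior ℝ (ConvexComposite.dom g))).Nonempty →
      (∀ p : E₁,
        IsLeast
          (Set.range fun v : E₂ =>
            ConvexComposite.conj g v +
              ConvexComposite.conj (ConvexComposite.scalarization v F) p)
          (ConvexComposite.conj (ConvexComposite.comp g F) p)) ∧
      (∀ x₀ ∈ ConvexComposite.dom (ConvexComposite.comp g F),
        ∀ y₀ : E₂, F x₀ = (y₀ : WithTop E₂) →
          ConvexComposite.subdiff (ConvexComposite.comp g F) x₀ =
            ⋃ v ∈ ConvexComposite.subdiff g y₀,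
              ConvexComposite.subdiff (ConvexComposite.scalarization v F) x₀) := by
  open ConvexComposite in
  have hinc := isIncreasingWrt_neg_hzn hg hα
  have hK : (0 : E₂) ∈ -hzn g α := by simpa using zero_mem_hzn g α
  refine ⟨hinc, ?_⟩
  rintro F hF ⟨_, ⟨a, ha, rfl⟩, ⟨b, hb, hab⟩⟩
  replace hab : F a = (b : WithTop E₂) := hab.symm
  refine ⟨fun p => ⟨?_, ?_⟩, fun x₀ hx₀ y₀ hy₀ => Set.Subset.antisymm (fun w hw => ?_) ?_⟩
  · have hbot : conj (comp g F) p ≠ ⊥ := by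
      refine ne_bot_of_le_ne_bot ?_ (inner_sub_le_conj (comp g F) p a)
      rw [comp_of_eq_coe hab]
      lift g b to ℝ using ⟨(intrinsicInterior_subset hb).ne, hg.ne_bot b⟩ with s
      exact EReal.coe_ne_bot _
    by_cases htop : conj (comp g F) p = ⊤
    -- If the value is `+∞`, weak duality makes every `v` a minimizer.
    · exact ⟨0, le_antisymm (htop ▸ le_top) (conj_comp_le hg.ne_bot F p 0)⟩
    · obtain ⟨β, hβ⟩ : ∃ β : ℝ, conj (comp g F) p = β :=
        ⟨_, (EReal.coe_toReal htop hbot).symm⟩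
      obtain ⟨v, hv⟩ := exists_multiplier hg.toMemΓ hK hinc hF hab ha hb (p := p) (β := β)
        (fun x y s hx hs => by
          have h1 := inner_sub_le_conj (comp g F) p x
          rw [hβ, comp_of_eq_coe hx] at h1
          have h2 := (EReal.sub_le_sub le_rfl hs).trans h1
          exact_mod_cast h2)
      exact ⟨v, le_antisymm (hβ ▸ conj_add_conj_le_of_multiplier hg.toMemΓ hab hv)
        (conj_comp_le hg.ne_bot F p v)⟩
  · rintro _ ⟨v, rfl⟩
    exact conj_comp_le hg.ne_bot F p v
  · have hfin : g y₀ < ⊤ := by simpa [dom, comp_of_eq_coe hy₀] using hx₀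
    obtain ⟨v, hv, hwv⟩ :=
      exists_mem_subdiff_of_mem_subdiff_comp hg.toMemΓ hK hinc hF hab ha hb hy₀ hfin hw
    exact Set.mem_biUnion hv hwv
  · exact Set.iUnion₂_subset fun v hv w hw => mem_subdiff_comp hy₀ hv hw
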